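/- Let $\mathbb F$ be a division ring, $\sigma$ an automorphism of $\mathbb F$, $\delta:\mathbb F\to\mathbb F$ a $\sigma$-derivation (an additive map with $\delta(ab)=\sigma(a)\delta(b)+\delta(a)b$), and $\mathcal R=\mathbb F[x;\sigma,\delta]$ the Ore extension: the ring of polynomials $\sum_i a_ix^i$ with $a_i\in\mathbb F$, with the usual sum and the product determined by $xa=\sigma(a)x+\delta(a)$. For $t,r\ge 0$ and $a\in\mathbb F$ let $\mathcal T_{t,r}(a)$ be the sum of all compositions of $t$ copies of $\delta\sigma^{-1}$ and $r$ copies of $\sigma^{-1}$, evaluated at $a$ (so $\mathcal T_{0,0}(a)=a$). Let $f=\sum_{i=0}^m a_ix^i$ and $g=\sum_{i=0}^n b_ix^i$ in $\mathcal R$ have positive degrees $m$ and $n$. Put $A_i=\sum_{j=0}^{m-i}(-1)^j\mathcal T_{j,i}(a_{j+i})$ for $0\le i\le m$ and $B_i=\sum_{j=0}^{n-i}(-1)^j\mathcal T_{j,i}(b_{j+i})$ for $0\le i\le n$, so that $f=\sum_i x^iA_i$ and $g=\sum_i x^iB_i$. The left $(\sigma,\delta)$-Sylvester matrix of $f$ and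 $g$ is the $(m+n)\times(m+n)$ matrix $M$ of the homogeneous linear system $$M\cdot(C_0,\dots,C_{n-1},D_0,\dots,D_{m-1})^T=0$$ that expresses $fc+gd=0$ for $c=\sum_{p<n}x^pC_p$ and $d=\sum_{p<m}x^pD_p$: its row with index $q$ ($0\le q<m+n$) corresponds to the power $x^q$, and its entries in row $q$ are $$\sum_{\substack{0\le l\le p\\ 0\le q-l\le m}}(-1)^{p-l}\mathcal T_{p-l,l}(A_{q-l})\quad\text{in the column of }C_p\ (0\le p<n),$$ $$\sum_{\substack{0\le l\le p\\ 0\le q-l\le n}}(-1)^{p-l}\mathcal T_{p-l,l}(B_{q-l})\quad\text{in the column of }D_p\ (0\le p<m).$$ The left $(\sigma,\delta)$-resultant $R^{\sigma,\delta}_{\mathbb F,L}(f,g)\in\{0\}\cup\mathbb F^*/[\mathbb F^*,\mathbb F^*]$ is the Dieudonné determinant of $M$. A greatest common left divisor of $f$ and $g$ is a common left divisor of $f$ and $g$ (an $h$ with $f,g\in h\mathcal R$) of which every common left divisor of $f$ and $g$ is a left divisor. Then $f$ and $g$ have exactly one monic greatest common left divisor, denoted $\mathrm{gcld}(f,g)$,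 and the following conditions are equivalent: 1. $R^{\sigma,\delta}_{\mathbb F,L}(f,g)=0$; 2. $f$ and $g$ have a common non-unit left factor in $\mathcal R$; 3. $\mathrm{gcld}(f,g)\ne 1$; 4. there are no $p,q\in\mathcal R$ such that $fp+gq=1$; 5. $f\mathcal R+g\mathcal R\subsetneq\mathcal R$. -/

import Mathlib

open Polynomial

/-- A `σ`-derivation of `F`: an additive map with `δ (a b) = σ(a) δ(b) + δ(a) b`. -/
structure SkewDerivation {F : Type*} [Ring F] (σ : F →+* F) extends F →+ F where
  leibniz' : ∀ a b : F, toFun (a * b) = σ a * toFun b + toFun a * b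

namespace SkewDerivation

variable {F : Type*} [Ring F] {σ : F →+* F}

instance : CoeFun (SkewDerivation σ) (fun _ => F → F) := ⟨fun δ => δ.toAddMonoidHom⟩

theorem leibniz (δ : SkewDerivation σ) (a b : F) : δ (a * b) = σ a * δ b + δ a * b :=
  δ.leibniz' a b

end SkewDerivation

/-- The Ore extension `F[x; σ, δ]`. An element is a polynomial `∑ aᵢ xⁱ` with coefficients written
on the left; `toPoly` only records the sequence of these coefficients (the product of `F[X]` plays
no role, the product of the Ore extension being the one defined below). -/
@[ext]
structure OrePolynomial {F : Type*} [Ring F] (σ : F →+* F) (δ : SkewDerivation σ) where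
  toPoly : F[X]

namespace OrePolynomial

noncomputable section

variable {F : Type*} [Ring F] {σ : F →+* F} {δ : SkewDerivation σ}

theorem end_mul_apply (S T : AddMonoid.End F[X]) (g : F[X]) : (S * T) g = S (T g) := rfl

theorem end_add_apply (S T : AddMonoid.End F[X]) (g : F[X]) : (S + T) g = S g + T g := rfl

variable (σ δ) in
/-- The map `g ↦ x g`, that is, `∑ bⱼ xʲ ↦ ∑ (σ(bⱼ) xʲ⁺¹ + δ(bⱼ) xʲ)`. -/
def xMul : AddMonoid.End F[X] where
  toFun g := g.sum fun j b => monomial (j + 1) (σ b) + monomial j (δ b)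
  map_zero' := by simp
  map_add' p q := by
    apply Polynomial.sum_add_index
    · simp
    · intro a b c; simp only [map_add]; abel

/-- Left multiplication of the coefficients by a scalar: `∑ bⱼ xʲ ↦ ∑ a bⱼ xʲ`. -/
def scalarMul (a : F) : AddMonoid.End F[X] := AddMonoidHom.mulLeft (Polynomial.C a)

theorem scalarMul_apply (a : F) (g : F[X]) : scalarMul a g = Polynomial.C a * g := rfl

variable (σ δ) in
/-- For `f = ∑ aᵢ xⁱ`, the map `g ↦ ∑ aᵢ (xⁱ g)`. -/
def opMul : F[X] →+ AddMonoid.End F[X] where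
  toFun f := f.sum fun i a => scalarMul a * xMul σ δ ^ i
  map_zero' := by simp
  map_add' p q := by
    apply Polynomial.sum_add_index
    · intro i; ext1 g; simp [scalarMul_apply, end_mul_apply]
    · intro i a b; ext1 g; simp [scalarMul_apply, add_mul, end_add_apply, end_mul_apply]

theorem xMul_monomial (j : ℕ) (b : F) :
    xMul σ δ (monomial j b) = monomial (j + 1) (σ b) + monomial j (δ b) :=
  Polynomial.sum_monomial_index (n := j) b
    (fun j b => monomial (j + 1) (σ b) + monomial j (δ b)) (by simp)

theorem opMul_monomial (i : ℕ) (a : F) :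
    opMul σ δ (monomial i a) = scalarMul a * xMul σ δ ^ i :=
  Polynomial.sum_monomial_index (n := i) a (fun i a => scalarMul a * xMul σ δ ^ i)
    (by ext1 g; simp [scalarMul_apply, end_mul_apply])

theorem xMul_mul_scalarMul (b : F) :
    xMul σ δ * scalarMul b = scalarMul (σ b) * xMul σ δ + scalarMul (δ b) := by
  ext1 g
  induction g using Polynomial.induction_on' with
  | add p q hp hq => simp only [map_add, hp, hq]
  | monomial n c =>
    simp [end_mul_apply, end_add_apply, scalarMul_apply, xMul_monomial, C_mul_monomial, mul_add, δ.leibniz,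
      add_assoc]

theorem opMul_scalarMul (a : F) (g : F[X]) :
    opMul σ δ (scalarMul a g) = scalarMul a * opMul σ δ g := by
  induction g using Polynomial.induction_on' with
  | add p q hp hq => simp only [map_add, hp, hq, mul_add]
  | monomial n c =>
    have : scalarMul a (monomial n c) = monomial n (a * c) := by simp [scalarMul_apply, C_mul_monomial]
    rw [this, opMul_monomial, opMul_monomial, ← mul_assoc]
    congr 1
    ext1 g; simp [scalarMul_apply, end_mul_apply, mul_assoc]

theorem opMul_xMul (g : F[X]) : opMul σ δ (xMul σ δ g) = xMul σ δ * opMul σ δ g := by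
  induction g using Polynomial.induction_on' with
  | add p q hp hq => simp only [map_add, hp, hq, mul_add]
  | monomial n c =>
    rw [xMul_monomial, map_add, opMul_monomial, opMul_monomial, opMul_monomial, ← mul_assoc,
      xMul_mul_scalarMul, add_mul, mul_assoc, ← pow_succ']

theorem opMul_pow_xMul (i : ℕ) (g : F[X]) :
    opMul σ δ ((xMul σ δ ^ i) g) = xMul σ δ ^ i * opMul σ δ g := by
  induction i with
  | zero => simp
  | succ i ih => rw [pow_succ', end_mul_apply, opMul_xMul, ih, mul_assoc]

theorem opMul_opMul (f g : F[X]) : opMul σ δ (opMul σ δ f g) = opMul σ δ f * opMul σ δ g := by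
  induction f using Polynomial.induction_on' with
  | add p q hp hq => simp only [map_add, end_add_apply, hp, hq, add_mul]
  | monomial n c =>
    rw [opMul_monomial, end_mul_apply, opMul_scalarMul, opMul_pow_xMul, mul_assoc]

theorem xMul_pow_one (i : ℕ) : (xMul σ δ ^ i) 1 = monomial i 1 := by
  have hδ : δ (1 : F) = 0 := by
    have := δ.leibniz 1 1
    simpa using this
  induction i with
  | zero => simp
  | succ i ih => rw [pow_succ', end_mul_apply, ih, xMul_monomial, hδ]; simp

theorem opMul_one_right (f : F[X]) : opMul σ δ f 1 = f := by
  induction f using Polynomial.induction_on' with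
  | add p q hp hq => simp only [map_add, end_add_apply, hp, hq]
  | monomial n c =>
    rw [opMul_monomial, end_mul_apply, xMul_pow_one]
    simp [scalarMul_apply, C_mul_monomial]

theorem opMul_one_left (f : F[X]) : opMul σ δ 1 f = f := by
  rw [← monomial_zero_one, opMul_monomial]
  simp [scalarMul_apply]

instance : Zero (OrePolynomial σ δ) := ⟨⟨0⟩⟩
instance : One (OrePolynomial σ δ) := ⟨⟨1⟩⟩
instance : Add (OrePolynomial σ δ) := ⟨fun f g => ⟨f.toPoly + g.toPoly⟩⟩
instance : Neg (OrePolynomial σ δ) := ⟨fun f => ⟨-f.toPoly⟩⟩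
instance : Mul (OrePolynomial σ δ) := ⟨fun f g => ⟨opMul σ δ f.toPoly g.toPoly⟩⟩

@[simp] theorem toPoly_zero : (0 : OrePolynomial σ δ).toPoly = 0 := rfl
@[simp] theorem toPoly_one : (1 : OrePolynomial σ δ).toPoly = 1 := rfl
@[simp] theorem toPoly_add (f g : OrePolynomial σ δ) :
    (f + g).toPoly = f.toPoly + g.toPoly := rfl
@[simp] theorem toPoly_neg (f : OrePolynomial σ δ) : (-f).toPoly = -f.toPoly := rfl
theorem toPoly_mul (f g : OrePolynomial σ δ) :
    (f * g).toPoly = opMul σ δ f.toPoly g.toPoly := rfl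

instance : Ring (OrePolynomial σ δ) where
  add_assoc _ _ _ := OrePolynomial.ext (add_assoc _ _ _)
  zero_add _ := OrePolynomial.ext (zero_add _)
  add_zero _ := OrePolynomial.ext (add_zero _)
  add_comm _ _ := OrePolynomial.ext (add_comm _ _)
  neg_add_cancel _ := OrePolynomial.ext (neg_add_cancel _)
  left_distrib f g h := by ext1; simp [toPoly_mul]
  right_distrib f g h := by ext1; simp [toPoly_mul, end_add_apply]
  zero_mul f := by ext1; simp [toPoly_mul]
  mul_zero f := by ext1; simp [toPoly_mul]
  mul_assoc f g h := by
    ext1; simp only [toPoly_mul, opMul_opMul, end_mul_apply]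
  one_mul f := by ext1; simp [toPoly_mul, opMul_one_left]
  mul_one f := by ext1; simp [toPoly_mul, opMul_one_right]
  nsmul := nsmulRec
  zsmul := zsmulRec

/-- The constant `a` as an element of the Ore extension. -/
def const (a : F) : OrePolynomial σ δ := ⟨Polynomial.C a⟩

/-- The variable `x` as an element of the Ore extension. -/
def x : OrePolynomial σ δ := ⟨Polynomial.X⟩

/-- The commutation rule `x a = σ(a) x + δ(a)` of the Ore extension. -/
theorem x_mul_const (a : F) :
    (x : OrePolynomial σ δ) * const a = const (σ a) * x + const (δ a) := by
  have h := xMul_monomial (σ := σ) (δ := δ) 0 a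
  simp only [monomial_zero_left, zero_add] at h
  ext1
  rw [toPoly_add, toPoly_mul, toPoly_mul]
  simp only [x, const]
  rw [← monomial_one_one_eq_X, ← monomial_zero_left (a := σ a), opMul_monomial, opMul_monomial]
  simp [end_mul_apply, scalarMul_apply, h]

/-- The left coefficient `aᵢ` of `f = ∑ aᵢ xⁱ`. -/
def coeff (f : OrePolynomial σ δ) (i : ℕ) : F := f.toPoly.coeff i

/-- The degree of `f` (with the convention that it is `0` for `f = 0`). -/
def natDegree (f : OrePolynomial σ δ) : ℕ := f.toPoly.natDegree

/-- `f = ∑ aᵢ xⁱ` is monic if its leading coefficient is `1`. -/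
def Monic (f : OrePolynomial σ δ) : Prop := f.coeff f.natDegree = 1

/-- `d` is a greatest common left divisor of `f` and `g`. In a noncommutative monoid `d ∣ f` means
`∃ u, f = d * u`, that is, `d` is a left factor of `f`. -/
def IsGCLD (f g d : OrePolynomial σ δ) : Prop :=
  d ∣ f ∧ d ∣ g ∧ ∀ e : OrePolynomial σ δ, e ∣ f → e ∣ g → e ∣ d

open Classical in
/-- `gcld f g`: the monic greatest common left divisor of `f` and `g` (and `0` if none exists). -/
def gcld (f g : OrePolynomial σ δ) : OrePolynomial σ δ :=
  if h : ∃ d : OrePolynomial σ δ, d.Monic ∧ IsGCLD f g d then h.choose else 0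

end

end OrePolynomial

noncomputable section

open Classical in
/-- The first row of `A` with a nonzero entry in the first column. -/
def pivotRow {F : Type*} [DivisionRing F] {n : ℕ} (A : Matrix (Fin (n + 1)) (Fin (n + 1)) F)
    (h : ∃ i, A i 0 ≠ 0) : Fin (n + 1) :=
  Fin.find (fun i => A i 0 ≠ 0) h

theorem pivotRow_spec {F : Type*} [DivisionRing F] {n : ℕ}
    (A : Matrix (Fin (n + 1)) (Fin (n + 1)) F) (h : ∃ i, A i 0 ≠ 0) : A (pivotRow A h) 0 ≠ 0 := by
  classical exact Fin.find_spec h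

/-- The matrix that remains of `A` when a left multiple of row `i` has been subtracted from every
other row, so as to clear the first column, and then row `i` and the first column have been
deleted. -/
def eliminate {F : Type*} [DivisionRing F] {n : ℕ} (A : Matrix (Fin (n + 1)) (Fin (n + 1)) F)
    (i : Fin (n + 1)) : Matrix (Fin n) (Fin n) F :=
  Matrix.of fun k j =>
    A (i.succAbove k) j.succ - A (i.succAbove k) 0 * (A i 0)⁻¹ * A i j.succ

open Classical in
/-- The Dieudonné determinant of a square matrix over a division ring, with values in
`{0} ∪ Fˣ/[Fˣ, Fˣ]`, computed by elimination along the first column with elementary row operations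
on the left: if the first column is zero the determinant is `0`; otherwise let `i` be the first row
with `A i 0 ≠ 0`, and then `Ddet A` is the class of `(-1)ⁱ (A i 0)` times the Dieudonné determinant
of the matrix that remains after clearing the first column by row `i`. -/
def dieudonneDet {F : Type*} [DivisionRing F] :
    {n : ℕ} → Matrix (Fin n) (Fin n) F → WithZero (Abelianization Fˣ)
  | 0, _ => 1
  | _ + 1, A =>
    if h : ∃ i, A i 0 ≠ 0 then
      ((Abelianization.of
        ((-1) ^ (pivotRow A h : ℕ) * Units.mk0 (A (pivotRow A h) 0) (pivotRow_spec A h)) :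
        Abelianization Fˣ) : WithZero (Abelianization Fˣ)) *
      dieudonneDet (eliminate A (pivotRow A h))
    else 0

namespace OrePolynomial

variable {F : Type*} [DivisionRing F] {σ : F ≃+* F} {δ : SkewDerivation (σ : F →+* F)}

/-- `𝒯_{t,r}(a)`: the sum of all compositions of `t` copies of `δ σ⁻¹` and `r` copies of `σ⁻¹`,
evaluated at `a`. A composition is given by a word `w` of length `t + r`, whose letters `true`
stand for `δ σ⁻¹` and `false` for `σ⁻¹`. -/
def opT (δ : SkewDerivation (σ : F →+* F)) (t r : ℕ) (a : F) : F :=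
  ∑ w : Fin (t + r) → Bool with (Finset.univ.filter fun i => w i = true).card = t,
    (List.ofFn fun i => if w i = true then fun b : F => δ (σ.symm b) else fun b : F => σ.symm b).foldr
      (fun φ b => φ b) a

/-- The right coefficients `𝒜ᵢ` of `f`, for which `f = ∑ aᵢ xⁱ = ∑ xⁱ 𝒜ᵢ`. -/
def rightCoeff (f : OrePolynomial (σ : F →+* F) δ) (i : ℕ) : F :=
  ∑ j ∈ Finset.range (f.natDegree - i + 1), (-1) ^ j * opT δ j i (f.coeff (j + i))

/-- The coefficient with which the unknown `Cₚ` enters, on the right, the coefficient of `x^q` of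
`f * ∑ xᵖ Cₚ` (written with coefficients on the right), namely
`∑_{l ≤ p, 0 ≤ q - l ≤ deg f} (-1)^(p-l) 𝒯_{p-l,l}(𝒜_{q-l})`. -/
def sylvesterEntry (f : OrePolynomial (σ : F →+* F) δ) (p q : ℕ) : F :=
  ∑ l ∈ Finset.range (p + 1),
    if l ≤ q ∧ q - l ≤ f.natDegree then (-1) ^ (p - l) * opT δ (p - l) l (f.rightCoeff (q - l))
    else 0

/-- The left `(σ, δ)`-Sylvester matrix `M` of `f` and `g`, of degrees `m` and `n`: the
`(m + n) × (m + n)` matrix of the homogeneous system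
`M (C₀, …, C_{n-1}, D₀, …, D_{m-1})ᵀ = 0` that expresses `f c + g d = 0` for `c = ∑ xᵖ Cₚ` and
`d = ∑ xᵖ Dₚ`. As the unknowns stand to the right of the entries, the equations are the rows
(indexed by the power `x^q`) and the unknowns are the columns. -/
def leftSylvester (f g : OrePolynomial (σ : F →+* F) δ) :
    Matrix (Fin (f.natDegree + g.natDegree)) (Fin (f.natDegree + g.natDegree)) F :=
  Matrix.of fun q p =>
    if (p : ℕ) < g.natDegree then f.sylvesterEntry p q
    else g.sylvesterEntry (p - g.natDegree) q

/-- The left `(σ, δ)`-resultant of `f` and `g`. -/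
def leftResultant (f g : OrePolynomial (σ : F →+* F) δ) : WithZero (Abelianization Fˣ) :=
  dieudonneDet (leftSylvester f g)

end OrePolynomial

end

/-! Since `σ` is onto, division with the quotient on the right is possible. Hence a nonzero element
of least degree in fR + gR, made monic by a constant on the right, is a greatest common left divisor
with a Bézout representation (`exists_monic_isGCLD`). Degrees add under multiplication, so one-sided
units are constants, and conditions 2, 3 and 5 become reformulations of condition 4.

For condition 1, the Sylvester matrix represents the right-linear map (c, d) ↦ fc + gd in right
coefficients (`leftSylvester_mulVec_eq_iff`), and its Dieudonné determinant vanishes iff it has a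
kernel (`dieudonneDet_eq_zero_iff`). A square matrix without kernel is onto, so 1 is attained.
Conversely, let fp + gq = 1 and let (c, d) be a nonzero kernel element; then c ≠ 0. Any y of degree
below m + n equals f(py) + g(qy); subtracting a right multiple of (c, d) reduces the first factor
modulo c, and comparing degrees bounds the second (`exists_combination_of_bezout`). The matrix is
therefore onto, hence injective, a contradiction. -/

namespace OrePolynomial

/-! ### Leading terms of products -/

section Ring

variable {F : Type*} [Ring F] {σ : F →+* F} {δ : SkewDerivation σ}

theorem coeff_xMul_succ (p : F[X]) (k : ℕ) :
    (xMul σ δ p).coeff (k + 1) = σ (p.coeff k) + δ (p.coeff (k + 1)) := by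
  induction p using Polynomial.induction_on' with
  | add p q hp hq => simp only [map_add, coeff_add, hp, hq]; abel
  | monomial n a =>
    rw [xMul_monomial, coeff_add]
    simp only [coeff_monomial, add_left_inj]
    split_ifs <;> simp

/-- The `δ` part of multiplication by x does not raise the degree, so only `σ` reaches the top. A
bound `n` in place of the exact degree lets zero polynomials through. -/
theorem coeff_xMul_pow (p : F[X]) {n : ℕ} (hp : p.natDegree ≤ n) (i : ℕ) :
    ((xMul σ δ ^ i) p).natDegree ≤ n + i ∧
      ((xMul σ δ ^ i) p).coeff (n + i) = (σ^[i]) (p.coeff n) := by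
  induction i with
  | zero => simpa using hp
  | succ i ih =>
    obtain ⟨h1, h2⟩ := ih
    rw [pow_succ', end_mul_apply]
    refine ⟨natDegree_le_iff_coeff_eq_zero.2 fun k hk => ?_, ?_⟩
    · obtain ⟨k, rfl⟩ : ∃ j, k = j + 1 := ⟨k - 1, by omega⟩
      rw [coeff_xMul_succ, coeff_eq_zero_of_natDegree_lt (by omega),
        coeff_eq_zero_of_natDegree_lt (by omega), map_zero, map_zero, add_zero]
    · rw [← add_assoc, coeff_xMul_succ, h2, Function.iterate_succ_apply',
        coeff_eq_zero_of_natDegree_lt (p := (xMul σ δ ^ i) p) (n := n + i + 1) (by omega),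
        map_zero, add_zero]

theorem opMul_eq_sum_range (p q : F[X]) {m : ℕ} (hp : p.natDegree ≤ m) :
    opMul σ δ p q = ∑ i ∈ Finset.range (m + 1), C (p.coeff i) * (xMul σ δ ^ i) q := by
  conv_lhs => rw [p.as_sum_range' (m + 1) (by omega)]
  rw [map_sum]
  refine (AddMonoidHom.finsetSum_apply _ _ _).trans ?_
  exact Finset.sum_congr rfl fun i _ => by rw [opMul_monomial]; rfl

theorem natDegree_opMul_le (p q : F[X]) {m n : ℕ} (hp : p.natDegree ≤ m) (hq : q.natDegree ≤ n) :
    (opMul σ δ p q).natDegree ≤ m + n := by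
  rw [opMul_eq_sum_range p q hp]
  refine natDegree_sum_le_of_forall_le _ _ fun i hi => ?_
  have := (coeff_xMul_pow (σ := σ) (δ := δ) q hq i).1
  have h2 := natDegree_C_mul_le (p.coeff i) ((xMul σ δ ^ i) q)
  rw [Finset.mem_range] at hi
  omega

theorem coeff_opMul_add (p q : F[X]) {m n : ℕ} (hp : p.natDegree ≤ m) (hq : q.natDegree ≤ n) :
    (opMul σ δ p q).coeff (m + n) = p.coeff m * (σ^[m]) (q.coeff n) := by
  rw [opMul_eq_sum_range p q hp, finsetSum_coeff, Finset.sum_range_succ, Finset.sum_eq_zero,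
    zero_add, coeff_C_mul, add_comm, (coeff_xMul_pow q hq m).2]
  intro i hi
  have := (coeff_xMul_pow (σ := σ) (δ := δ) q hq i).1
  rw [Finset.mem_range] at hi
  rw [coeff_C_mul, coeff_eq_zero_of_natDegree_lt (p := (xMul σ δ ^ i) q) (by omega), mul_zero]

variable (σ δ) in
/-- The constants of the Ore extension, as a ring homomorphism. -/
noncomputable def constHom : F →+* OrePolynomial σ δ where
  toFun := const
  map_zero' := by ext1; simp [const]
  map_one' := by ext1; simp [const]
  map_add' a b := by ext1; simp [const]
  map_mul' a b := by
    ext1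
    simp only [toPoly_mul, const, ← monomial_zero_left, opMul_monomial, pow_zero, mul_one,
      scalarMul_apply, monomial_mul_monomial, add_zero]

variable (σ δ) in
/-- The sequence of left coefficients, as an additive homomorphism. -/
def toPolyHom : OrePolynomial σ δ →+ F[X] where
  toFun := toPoly
  map_zero' := rfl
  map_add' _ _ := rfl

theorem toPoly_sub (f g : OrePolynomial σ δ) : (f - g).toPoly = f.toPoly - g.toPoly :=
  map_sub (toPolyHom σ δ) f g

theorem toPoly_sum {ι : Type*} (s : Finset ι) (f : ι → OrePolynomial σ δ) :
    (∑ i ∈ s, f i).toPoly = ∑ i ∈ s, (f i).toPoly :=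
  map_sum (toPolyHom σ δ) f s

theorem toPoly_eq_zero {f : OrePolynomial σ δ} : f.toPoly = 0 ↔ f = 0 :=
  ⟨fun h => OrePolynomial.ext h, fun h => h ▸ rfl⟩

theorem toPoly_constHom (a : F) : (constHom σ δ a).toPoly = C a := rfl

/-- Powers of x agree in the two products because `σ` fixes 1 and `δ` kills it. -/
theorem toPoly_x_pow (i : ℕ) : ((x : OrePolynomial σ δ) ^ i).toPoly = X ^ i := by
  induction i with
  | zero => simp
  | succ i ih =>
    rw [pow_succ', toPoly_mul, ih, ← monomial_one_right_eq_X_pow, ← monomial_one_right_eq_X_pow]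
    have hx : (x : OrePolynomial σ δ).toPoly = monomial 1 1 := monomial_one_one_eq_X.symm
    rw [hx, opMul_monomial, end_mul_apply, pow_one, ← xMul_pow_one (σ := σ) (δ := δ) i,
      ← end_mul_apply (xMul σ δ), ← pow_succ', xMul_pow_one, scalarMul_apply, C_1, one_mul]

theorem toPoly_constHom_mul_x_pow (a : F) (i : ℕ) :
    (constHom σ δ a * x ^ i).toPoly = monomial i a := by
  rw [toPoly_mul, toPoly_x_pow, toPoly_constHom, ← monomial_zero_left, opMul_monomial, pow_zero,
    mul_one, scalarMul_apply, C_mul_X_pow_eq_monomial]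

end Ring

/-! ### Additivity of degrees, units and monic elements -/

section DivisionRing

variable {F : Type*} [DivisionRing F] {σ : F →+* F} {δ : SkewDerivation σ}

/-- The candidate leading coefficient is a σ^m(b) with a, b nonzero, and `σ` is injective on a
division ring. -/
theorem degree_mul (f g : OrePolynomial σ δ) :
    (f * g).toPoly.degree = f.toPoly.degree + g.toPoly.degree := by
  rcases eq_or_ne f 0 with rfl | hf
  · simp
  rcases eq_or_ne g 0 with rfl | hg
  · simp
  have hf' : f.toPoly ≠ 0 := fun h => hf (toPoly_eq_zero.1 h)
  have hg' : g.toPoly ≠ 0 := fun h => hg (toPoly_eq_zero.1 h)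
  have hc := coeff_opMul_add (σ := σ) (δ := δ) f.toPoly g.toPoly le_rfl le_rfl
  rw [← toPoly_mul] at hc
  have hne : (f * g).toPoly.coeff (f.toPoly.natDegree + g.toPoly.natDegree) ≠ 0 := by
    rw [hc]
    refine mul_ne_zero (leadingCoeff_ne_zero.2 hf') ?_
    rw [← RingHom.coe_pow, _root_.map_ne_zero]
    exact leadingCoeff_ne_zero.2 hg'
  rw [degree_eq_natDegree hf', degree_eq_natDegree hg', ← Nat.cast_add]
  refine le_antisymm (natDegree_le_iff_degree_le.1 ?_) (le_degree_of_ne_zero hne)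
  exact natDegree_opMul_le _ _ le_rfl le_rfl

instance : NoZeroDivisors (OrePolynomial σ δ) where
  eq_zero_or_eq_zero_of_mul_eq_zero {f g} h := by
    have := degree_mul f g
    rw [h, toPoly_zero, degree_zero, eq_comm, WithBot.add_eq_bot] at this
    simpa only [degree_eq_bot, toPoly_eq_zero] using this

theorem Monic.ne_zero {f : OrePolynomial σ δ} (hf : f.Monic) : f ≠ 0 := by
  rintro rfl
  simp [Monic, coeff] at hf

theorem degree_eq_zero_of_mul_eq_one {f g : OrePolynomial σ δ} (h : f * g = 1) :
    f.toPoly.degree = 0 := by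
  have := degree_mul f g
  rw [h, toPoly_one, degree_one, eq_comm, Nat.WithBot.add_eq_zero_iff] at this
  exact this.1

theorem exists_eq_constHom {f : OrePolynomial σ δ} (h : f.toPoly.degree = 0) :
    ∃ a : F, a ≠ 0 ∧ f = constHom σ δ a := by
  refine ⟨f.toPoly.coeff 0, fun h0 => ?_, ?_⟩
  · rw [eq_C_of_degree_eq_zero h, h0] at h
    simp at h
  · ext1
    exact eq_C_of_degree_eq_zero h

theorem Monic.eq_one_of_degree {f : OrePolynomial σ δ} (hf : f.Monic)
    (h : f.toPoly.degree = 0) : f = 1 := by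
  obtain ⟨a, -, rfl⟩ := exists_eq_constHom h
  have : a = 1 := by simpa [Monic, coeff, natDegree, toPoly_constHom] using hf
  rw [this, map_one]

theorem isUnit_of_mul_eq_one {f g : OrePolynomial σ δ} (h : f * g = 1) : IsUnit f := by
  obtain ⟨a, ha, rfl⟩ := exists_eq_constHom (degree_eq_zero_of_mul_eq_one h)
  exact (IsUnit.mk0 a ha).map (constHom σ δ)

theorem coeff_mul_constHom (f : OrePolynomial σ δ) (a : F) :
    (f * constHom σ δ a).coeff f.natDegree =
      f.coeff f.natDegree * (σ^[f.natDegree]) a := by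
  have h := coeff_opMul_add (σ := σ) (δ := δ) f.toPoly (C a) (n := 0) le_rfl (by simp)
  rwa [add_zero, coeff_C_zero] at h

theorem natDegree_mul_constHom (f : OrePolynomial σ δ) {a : F} (ha : a ≠ 0) :
    (f * constHom σ δ a).natDegree = f.natDegree := by
  refine natDegree_eq_of_degree_eq ?_
  rw [degree_mul, toPoly_constHom, degree_C ha, add_zero]

/-- Monic polynomials that divide each other on the left are equal. -/
theorem Monic.eq_of_dvd_dvd {f g : OrePolynomial σ δ} (hf : f.Monic) (hg : g.Monic)
    (hfg : f ∣ g) (hgf : g ∣ f) : f = g := by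
  obtain ⟨u, rfl⟩ := hfg
  obtain ⟨v, hv⟩ := hgf
  have huv : u * v = 1 := by
    refine mul_left_cancel₀ hf.ne_zero ?_
    rw [← mul_assoc, ← hv, mul_one]
  obtain ⟨a, ha, rfl⟩ := exists_eq_constHom (degree_eq_zero_of_mul_eq_one huv)
  -- Comparing leading coefficients gives σ^m(a) = 1, whence a = 1.
  rw [Monic, natDegree_mul_constHom f ha, coeff_mul_constHom, hf, one_mul, ← RingHom.coe_pow,
    ← map_one (σ ^ f.natDegree)] at hg
  rw [(σ ^ f.natDegree).injective hg, map_one, mul_one]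

end DivisionRing

/-! ### Division algorithm and greatest common left divisors -/

section Automorphism

variable {F : Type*} [DivisionRing F] {σ : F ≃+* F} {δ : SkewDerivation (σ : F →+* F)}

theorem exists_iterate_eq (k : ℕ) (b : F) : ∃ c : F, (((σ : F →+* F) : F → F)^[k]) c = b :=
  (Function.Surjective.iterate (f := ((σ : F →+* F) : F → F)) σ.surjective k) b

/-- Division with remainder, the quotient being on the right. -/
theorem exists_eq_mul_add (g : OrePolynomial (σ : F →+* F) δ) (hg : g ≠ 0)
    (f : OrePolynomial (σ : F →+* F) δ) :
    ∃ q r, f = g * q + r ∧ r.toPoly.degree < g.toPoly.degree := by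
  have hg' : g.toPoly ≠ 0 := fun h => hg (toPoly_eq_zero.1 h)
  induction h : f.toPoly.degree using WellFoundedLT.induction generalizing f with
  | ind d ih =>
    subst h
    by_cases hlt : f.toPoly.degree < g.toPoly.degree
    · exact ⟨0, f, by simp, hlt⟩
    have hle := not_lt.1 hlt
    have hf' : f.toPoly ≠ 0 := by
      intro h0
      rw [h0, degree_zero, le_bot_iff, degree_eq_bot] at hle
      exact hg' hle
    have hnle := natDegree_le_natDegree hle
    -- Cancelling the leading term of `f` by g · c xᵏ requires lead(g) σⁿ(c) = lead(f) with n = deg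
    -- g; solving for c uses that `σ` is onto.
    obtain ⟨c, hc⟩ := exists_iterate_eq (σ := σ) g.toPoly.natDegree
      (g.toPoly.leadingCoeff⁻¹ * f.toPoly.leadingCoeff)
    have hc0 : c ≠ 0 := by
      rintro rfl
      rw [← RingHom.coe_pow, map_zero, eq_comm, mul_eq_zero, inv_eq_zero, leadingCoeff_eq_zero,
        leadingCoeff_eq_zero] at hc
      tauto
    set k := f.toPoly.natDegree - g.toPoly.natDegree with hk
    set q₀ : OrePolynomial (σ : F →+* F) δ := constHom _ _ c * x ^ k with hq₀
    have hq : q₀.toPoly = monomial k c := toPoly_constHom_mul_x_pow c k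
    have hdeg : f.toPoly.degree = (g * q₀).toPoly.degree := by
      rw [degree_mul, hq, degree_monomial k hc0, degree_eq_natDegree hf', degree_eq_natDegree hg',
        ← Nat.cast_add, hk]
      congr 1
      omega
    have hlead : f.toPoly.leadingCoeff = (g * q₀).toPoly.leadingCoeff := by
      have h1 := coeff_opMul_add (σ := (σ : F →+* F)) (δ := δ) g.toPoly q₀.toPoly (n := k) le_rfl
        (by rw [hq]; exact natDegree_monomial_le c)
      rw [← toPoly_mul, hq, coeff_monomial, if_pos rfl, hc, coeff_natDegree,
        mul_inv_cancel_left₀ (leadingCoeff_ne_zero.2 hg')] at h1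
      rw [← h1, leadingCoeff, ← natDegree_eq_of_degree_eq hdeg]
      congr 1
      omega
    have hlt' := degree_sub_lt_left hdeg hf' hlead
    rw [← toPoly_sub] at hlt'
    obtain ⟨q, r, hqr, hr⟩ := ih _ hlt' (f - g * q₀) rfl
    refine ⟨q₀ + q, r, ?_, hr⟩
    rw [mul_add, add_assoc, ← hqr, add_sub_cancel]

theorem exists_monic_mul_constHom (f : OrePolynomial (σ : F →+* F) δ) (hf : f ≠ 0) :
    ∃ a : F, a ≠ 0 ∧ (f * constHom _ _ a).Monic := by
  have hf' : f.toPoly.leadingCoeff ≠ 0 :=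
    leadingCoeff_ne_zero.2 fun h => hf (toPoly_eq_zero.1 h)
  obtain ⟨c, hc⟩ := exists_iterate_eq (σ := σ) f.natDegree f.toPoly.leadingCoeff⁻¹
  have hc0 : c ≠ 0 := by
    rintro rfl
    rw [← RingHom.coe_pow, map_zero] at hc
    exact inv_ne_zero hf' hc.symm
  refine ⟨c, hc0, ?_⟩
  rw [Monic, natDegree_mul_constHom f hc0, coeff_mul_constHom, hc]
  exact mul_inv_cancel₀ hf'

/-- A monic greatest common left divisor exists, in the form of a Bézout combination. -/
theorem exists_monic_isGCLD (f g : OrePolynomial (σ : F →+* F) δ) (hf : f ≠ 0) :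
    ∃ d : OrePolynomial (σ : F →+* F) δ, d.Monic ∧ IsGCLD f g d ∧
      ∃ p q, f * p + g * q = d := by
  let S : Set (OrePolynomial (σ : F →+* F) δ) := {d | d ≠ 0 ∧ ∃ p q, f * p + g * q = d}
  have hS : S.Nonempty := ⟨f, hf, 1, 0, by simp⟩
  obtain ⟨d, ⟨hd, p, q, hpq⟩, hmin⟩ := WellFounded.has_min
    (InvImage.wf (fun d : OrePolynomial (σ : F →+* F) δ => d.toPoly.degree) wellFounded_lt) S hS
  have hdvd : ∀ h : OrePolynomial (σ : F →+* F) δ, (∃ u v, f * u + g * v = h) → d ∣ h := by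
    rintro h ⟨u, v, huv⟩
    obtain ⟨k, r, hk, hr⟩ := exists_eq_mul_add d hd h
    by_cases hr0 : r = 0
    · exact ⟨k, by rw [hk, hr0, add_zero]⟩
    -- A nonzero remainder would be a combination of `f` and `g` of smaller degree than `d`.
    · refine absurd hr (hmin r ⟨hr0, u - p * k, v - q * k, ?_⟩)
      rw [← sub_eq_iff_eq_add'] at hk
      rw [← hk, ← huv, ← hpq]
      noncomm_ring
  obtain ⟨a, ha, hmonic⟩ := exists_monic_mul_constHom d hd
  have hdiv : ∀ h, d ∣ h → d * constHom _ _ a ∣ h := by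
    rintro _ ⟨k, rfl⟩
    refine ⟨constHom _ _ a⁻¹ * k, ?_⟩
    rw [mul_assoc, ← mul_assoc (constHom _ _ a), ← map_mul, mul_inv_cancel₀ ha, map_one, one_mul]
  refine ⟨d * constHom _ _ a, hmonic, ⟨hdiv f (hdvd f ⟨1, 0, by simp⟩),
    hdiv g (hdvd g ⟨0, 1, by simp⟩), fun e hef heg => ?_⟩, p * constHom _ _ a,
    q * constHom _ _ a, ?_⟩
  · rw [← hpq]
    exact ((hef.mul_right p).add (heg.mul_right q)).mul_right _
  · rw [← hpq, add_mul, mul_assoc, mul_assoc]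

theorem existsUnique_monic_isGCLD (f g : OrePolynomial (σ : F →+* F) δ) (hf : f ≠ 0) :
    ∃! d : OrePolynomial (σ : F →+* F) δ, d.Monic ∧ IsGCLD f g d := by
  obtain ⟨d, hd, hgcd, -⟩ := exists_monic_isGCLD f g hf
  refine ⟨d, ⟨hd, hgcd⟩, fun e he => ?_⟩
  exact he.1.eq_of_dvd_dvd hd (hgcd.2.2 e he.2.1 he.2.2.1) (he.2.2.2 d hgcd.1 hgcd.2.1)

theorem gcld_spec (f g : OrePolynomial (σ : F →+* F) δ) (hf : f ≠ 0) :
    (gcld f g).Monic ∧ IsGCLD f g (gcld f g) := by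
  have h := (existsUnique_monic_isGCLD f g hf).exists
  rw [gcld, dif_pos h]
  exact h.choose_spec

theorem gcld_eq_one_iff (f g : OrePolynomial (σ : F →+* F) δ) (hf : f ≠ 0) :
    gcld f g = 1 ↔ ∃ p q : OrePolynomial (σ : F →+* F) δ, f * p + g * q = 1 := by
  constructor
  · intro h
    obtain ⟨d, hd, hgcd, p, q, hpq⟩ := exists_monic_isGCLD f g hf
    refine ⟨p, q, hpq.trans ?_⟩
    rw [← h]
    exact (existsUnique_monic_isGCLD f g hf).unique ⟨hd, hgcd⟩ (gcld_spec f g hf)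
  · rintro ⟨p, q, hpq⟩
    obtain ⟨hm, hdf, hdg, -⟩ := gcld_spec f g hf
    obtain ⟨u, hu⟩ : gcld f g ∣ 1 := hpq ▸ (hdf.mul_right p).add (hdg.mul_right q)
    exact hm.eq_one_of_degree (degree_eq_zero_of_mul_eq_one hu.symm)

theorem exists_common_left_factor_iff (f g : OrePolynomial (σ : F →+* F) δ) (hf : f ≠ 0) :
    (∃ h : OrePolynomial (σ : F →+* F) δ, ¬ IsUnit h ∧ h ∣ f ∧ h ∣ g) ↔ gcld f g ≠ 1 := by
  obtain ⟨hm, hdf, hdg, hmax⟩ := gcld_spec f g hf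
  constructor
  · rintro ⟨h, hu, hhf, hhg⟩ h1
    obtain ⟨u, hu'⟩ := hmax h hhf hhg
    exact hu (isUnit_of_mul_eq_one (hu'.symm.trans h1))
  · refine fun h1 => ⟨gcld f g, fun hu => h1 ?_, hdf, hdg⟩
    obtain ⟨v, hv⟩ := hu.exists_right_inv
    exact hm.eq_one_of_degree (degree_eq_zero_of_mul_eq_one hv)

/-- Right ideals are submodules over `Rᵐᵒᵖ`; such a sum is everything exactly when it contains 1. -/
theorem span_sup_span_lt_top_iff {R : Type*} [Ring R] (f g : R) :
    Submodule.span Rᵐᵒᵖ {f} ⊔ Submodule.span Rᵐᵒᵖ {g} < ⊤ ↔ ¬ ∃ p q : R, f * p + g * q = 1 := by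
  rw [lt_top_iff_ne_top, not_iff_not]
  constructor
  · intro h
    have h1 : (1 : R) ∈ Submodule.span Rᵐᵒᵖ {f} ⊔ Submodule.span Rᵐᵒᵖ {g} := h ▸ Submodule.mem_top
    obtain ⟨_, hy, _, hz, hyz⟩ := Submodule.mem_sup.1 h1
    obtain ⟨a, rfl⟩ := Submodule.mem_span_singleton.1 hy
    obtain ⟨b, rfl⟩ := Submodule.mem_span_singleton.1 hz
    exact ⟨a.unop, b.unop, hyz⟩
  · rintro ⟨p, q, hpq⟩
    refine eq_top_iff.2 fun r _ => Submodule.mem_sup.2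
      ⟨f * (p * r), Submodule.mem_span_singleton.2 ⟨MulOpposite.op (p * r), rfl⟩,
        g * (q * r), Submodule.mem_span_singleton.2 ⟨MulOpposite.op (q * r), rfl⟩, ?_⟩
    rw [← mul_assoc, ← mul_assoc, ← add_mul, hpq, one_mul]

end Automorphism

end OrePolynomial

/-! ### Dieudonné determinant and kernels -/

section Dieudonne

variable {F : Type*} [DivisionRing F]

open Matrix in
/-- The Dieudonné determinant vanishes exactly on the matrices with a nontrivial right kernel. -/
theorem dieudonneDet_eq_zero_iff {n : ℕ} (A : Matrix (Fin n) (Fin n) F) :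
    dieudonneDet A = 0 ↔ ∃ v : Fin n → F, v ≠ 0 ∧ A *ᵥ v = 0 := by
  induction n with
  | zero =>
    rw [dieudonneDet]
    exact iff_of_false one_ne_zero fun ⟨v, hv, _⟩ => hv (Subsingleton.elim _ _)
  | succ n ih =>
    rw [dieudonneDet]
    split_ifs with h
    · have hp := pivotRow_spec A h
      rw [mul_eq_zero, or_iff_right WithZero.coe_ne_zero, ih]
      -- Only the nonvanishing of the pivot matters from here on, not which row was chosen.
      generalize pivotRow A h = i at hp ⊢
      have row : ∀ (v : Fin (n + 1) → F) (k : Fin (n + 1)),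
          (A *ᵥ v) k = A k 0 * v 0 + ∑ j : Fin n, A k j.succ * v j.succ := by
        intro v k
        rw [mulVec, dotProduct, Fin.sum_univ_succ]
      have elim : ∀ (v : Fin n → F) (k : Fin n),
          (eliminate A i *ᵥ v) k = ∑ j : Fin n, A (i.succAbove k) j.succ * v j -
            A (i.succAbove k) 0 * ((A i 0)⁻¹ * ∑ j : Fin n, A i j.succ * v j) := by
        intro v k
        rw [mulVec, dotProduct, Finset.mul_sum, Finset.mul_sum, ← Finset.sum_sub_distrib]
        refine Finset.sum_congr rfl fun j _ => ?_
        rw [eliminate, of_apply, sub_mul]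
        simp only [mul_assoc]
      constructor
      · rintro ⟨v, hv, hAv⟩
        -- The missing first coordinate is the one forced by the pivot row.
        refine ⟨Fin.cons (-((A i 0)⁻¹ * ∑ j : Fin n, A i j.succ * v j)) v, fun h0 => hv ?_, ?_⟩
        · ext j
          simpa using congrFun h0 j.succ
        · ext k
          rw [row]
          simp only [Fin.cons_zero, Fin.cons_succ, Pi.zero_apply]
          rcases Fin.eq_self_or_eq_succAbove i k with rfl | ⟨k, rfl⟩
          · rw [mul_neg, mul_inv_cancel_left₀ hp, neg_add_cancel]
          · have := congrFun hAv k
            rw [elim, Pi.zero_apply] at this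
            rw [mul_neg, neg_add_eq_sub, this]
      · rintro ⟨v, hv, hAv⟩
        have h0 : v 0 = -((A i 0)⁻¹ * ∑ j : Fin n, A i j.succ * v j.succ) := by
          have := congrFun hAv i
          rw [row, Pi.zero_apply] at this
          rw [← mul_neg, ← eq_neg_of_add_eq_zero_left this, inv_mul_cancel_left₀ hp]
        refine ⟨fun j => v j.succ, fun ht => hv ?_, ?_⟩
        · have ht' : ∀ j : Fin n, v j.succ = 0 := fun j => congrFun ht j
          ext j
          refine Fin.cases ?_ ht' j
          rw [h0]
          simp [ht']
        · ext k
          have := congrFun hAv (i.succAbove k)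
          rw [row, h0, mul_neg, neg_add_eq_sub] at this
          rw [elim, this, Pi.zero_apply, Pi.zero_apply]
    · push Not at h
      -- With a zero first column, the first basis vector lies in the kernel.
      refine iff_of_true rfl ⟨Pi.single 0 1, by simp, ?_⟩
      ext k
      simp [h k]

/-- A square matrix over a division ring acts injectively on columns iff it acts surjectively. -/
theorem mulVec_injective_iff_surjective {n : ℕ} (A : Matrix (Fin n) (Fin n) F) :
    Function.Injective A.mulVec ↔ Function.Surjective A.mulVec := by
  have : Module.Finite Fᵐᵒᵖ F := by
    refine ⟨⟨{1}, eq_top_iff.2 fun a _ => ?_⟩⟩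
    rw [Finset.coe_singleton]
    exact Submodule.mem_span_singleton.2 ⟨MulOpposite.op a, by simp⟩
  -- The entries multiply on the left, so the map is linear for scalars on the right.
  let φ : (Fin n → F) →ₗ[Fᵐᵒᵖ] (Fin n → F) :=
    { toFun := A.mulVec
      map_add' := A.mulVec_add
      map_smul' := fun a v => A.mulVec_smul a v }
  exact LinearMap.injective_iff_surjective (f := φ)

end Dieudonne

namespace OrePolynomial

/-! ### Expansions with coefficients on the right -/

section RightCoefficients

variable {F : Type*} [DivisionRing F] {σ : F ≃+* F} {δ : SkewDerivation (σ : F →+* F)}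

/-- The composition of `δ σ⁻¹` and `σ⁻¹` spelled by a word, the letters `true` standing for
`δ σ⁻¹`. -/
def wordMap (δ : SkewDerivation (σ : F →+* F)) {n : ℕ} (w : Fin n → Bool) (a : F) : F :=
  (List.ofFn fun i => if w i = true then fun b : F => δ (σ.symm b)
    else fun b : F => σ.symm b).foldr (fun φ b => φ b) a

theorem wordMap_cons_true {n : ℕ} (w : Fin n → Bool) (a : F) :
    wordMap δ (Fin.cons true w : Fin (n + 1) → Bool) a = δ (σ.symm (wordMap δ w a)) := by
  simp [wordMap, List.ofFn_succ]

theorem wordMap_cons_false {n : ℕ} (w : Fin n → Bool) (a : F) :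
    wordMap δ (Fin.cons false w : Fin (n + 1) → Bool) a = σ.symm (wordMap δ w a) := by
  simp [wordMap, List.ofFn_succ]

theorem card_filter_cons {n : ℕ} (b c : Bool) (w : Fin n → Bool) :
    (Finset.univ.filter fun i => (Fin.cons b w : Fin (n + 1) → Bool) i = c).card =
      (Finset.univ.filter fun i => w i = c).card + if b = c then 1 else 0 := by
  rw [Fin.card_filter_univ_succ]
  simp only [Fin.cons_zero, Fin.cons_succ]
  split_ifs <;> rfl

/-- This is the commutation rule at σ⁻¹(a), solved for a x. -/
theorem constHom_mul_x (a : F) :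
    constHom (σ : F →+* F) δ a * x =
      x * constHom _ _ (σ.symm a) - constHom _ _ (δ (σ.symm a)) := by
  have h := x_mul_const (σ := (σ : F →+* F)) (δ := δ) (σ.symm a)
  rw [RingEquiv.coe_toRingHom, RingEquiv.apply_symm_apply] at h
  exact eq_sub_of_add_eq h.symm

/-- Each x that the constant passes either moves to the left, applying σ⁻¹, or is absorbed, applying
-δσ⁻¹. A word records these choices. The last x passed acts outermost, hence as the head of the
word. -/
theorem constHom_mul_x_pow_eq_sum_words (a : F) (n : ℕ) :
    constHom (σ : F →+* F) δ a * x ^ n =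
      ∑ w : Fin n → Bool, (-1) ^ (Finset.univ.filter fun i => w i = true).card *
        (x ^ (Finset.univ.filter fun i => w i = false).card * constHom _ _ (wordMap δ w a)) := by
  induction n with
  | zero => simp [wordMap]
  | succ n ih =>
    rw [pow_succ, ← mul_assoc, ih, Finset.sum_mul,
      ← (Fin.consEquiv fun _ : Fin (n + 1) => Bool).sum_comp, Fintype.sum_prod_type,
      Fintype.sum_bool, ← Finset.sum_add_distrib]
    refine Finset.sum_congr rfl fun w _ => ?_
    change _ = (-1) ^ (Finset.univ.filter fun i => (Fin.cons true w : Fin (n + 1) → Bool) i =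
        true).card * (x ^ (Finset.univ.filter fun i => (Fin.cons true w : Fin (n + 1) → Bool) i =
        false).card * constHom _ _ (wordMap δ (Fin.cons true w : Fin (n + 1) → Bool) a)) +
      (-1) ^ (Finset.univ.filter fun i => (Fin.cons false w : Fin (n + 1) → Bool) i =
        true).card * (x ^ (Finset.univ.filter fun i => (Fin.cons false w : Fin (n + 1) → Bool) i =
        false).card * constHom _ _ (wordMap δ (Fin.cons false w : Fin (n + 1) → Bool) a))
    simp only [card_filter_cons, wordMap_cons_true, wordMap_cons_false]
    simp only [if_true, reduceCtorEq, if_false, add_zero]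
    rw [mul_assoc, mul_assoc, constHom_mul_x, mul_sub, mul_sub, pow_succ, pow_succ]
    simp only [mul_assoc, neg_mul, one_mul, mul_neg, sub_eq_neg_add]

theorem card_filter_true_add_card_filter_false {n : ℕ} (w : Fin n → Bool) :
    (Finset.univ.filter fun i => w i = true).card +
      (Finset.univ.filter fun i => w i = false).card = n := by
  have := Finset.card_filter_add_card_filter_not (s := (Finset.univ : Finset (Fin n)))
    (fun i => w i = true)
  simpa using this

theorem sum_words_eq_opT (a : F) (t l : ℕ) :
    ∑ w : Fin (t + l) → Bool with (Finset.univ.filter fun i => w i = false).card = l,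
      (-1) ^ (Finset.univ.filter fun i => w i = true).card *
        (x ^ (Finset.univ.filter fun i => w i = false).card *
          constHom (σ : F →+* F) δ (wordMap δ w a)) =
      x ^ l * constHom _ _ ((-1) ^ t * opT δ t l a) := by
  have hcard : ∀ w : Fin (t + l) → Bool, (Finset.univ.filter fun i => w i = false).card = l ↔
      (Finset.univ.filter fun i => w i = true).card = t := fun w => by
    have := card_filter_true_add_card_filter_false w
    omega
  -- The sign is central, so it can cross the power of x.
  have hcomm : Commute ((x : OrePolynomial (σ : F →+* F) δ) ^ l) ((-1) ^ t) :=
    (Commute.neg_one_right _).pow_right t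
  rw [opT, map_mul, map_pow, map_neg, map_one, ← mul_assoc, hcomm.eq, mul_assoc, map_sum,
    Finset.mul_sum, Finset.mul_sum]
  refine Finset.sum_congr (Finset.filter_congr fun w _ => hcard w) fun w hw => ?_
  rw [(Finset.mem_filter.1 hw).2, (hcard w).2 (Finset.mem_filter.1 hw).2]
  rfl

/-- The expansion `a xᵖ = ∑ xˡ (-1)^(p-l) 𝒯_{p-l,l}(a)`. -/
theorem constHom_mul_x_pow (a : F) (p : ℕ) :
    constHom (σ : F →+* F) δ a * x ^ p =
      ∑ l ∈ Finset.range (p + 1), x ^ l * constHom _ _ ((-1) ^ (p - l) * opT δ (p - l) l a) := by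
  -- Words are grouped by their number of letters `false`, the surviving power of x.
  rw [constHom_mul_x_pow_eq_sum_words, ← Finset.sum_fiberwise_of_maps_to
    (t := Finset.range (p + 1)) (g := fun w => (Finset.univ.filter fun i => w i = false).card)]
  · refine Finset.sum_congr rfl fun l hl => ?_
    obtain ⟨t, rfl⟩ : ∃ t, p = t + l := ⟨p - l, by rw [Finset.mem_range] at hl; omega⟩
    rw [Nat.add_sub_cancel]
    exact sum_words_eq_opT a t l
  · intro w _
    rw [Finset.mem_range]
    have := card_filter_true_add_card_filter_false w
    omega

/-- `f = ∑ xⁱ 𝒜ᵢ`. -/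
theorem eq_sum_rightCoeff (f : OrePolynomial (σ : F →+* F) δ) :
    f = ∑ i ∈ Finset.range (f.natDegree + 1), x ^ i * constHom _ _ (f.rightCoeff i) := by
  have hsum : f = ∑ k ∈ Finset.range (f.natDegree + 1), constHom _ _ (f.coeff k) * x ^ k := by
    ext1
    rw [toPoly_sum]
    simp only [toPoly_constHom_mul_x_pow]
    exact f.toPoly.as_sum_range' _ (Nat.lt_succ_self _)
  conv_lhs => rw [hsum]
  simp only [constHom_mul_x_pow]
  -- The triangle l ≤ k ≤ deg f is summed by columns; then k = l + j.
  rw [Finset.sum_comm' (t' := Finset.range (f.natDegree + 1))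
    (s' := fun l => Finset.Ico l (f.natDegree + 1))]
  · refine Finset.sum_congr rfl fun l hl => ?_
    rw [Finset.sum_Ico_eq_sum_range, rightCoeff, map_sum, Finset.mul_sum,
      Nat.sub_add_comm (Nat.lt_succ_iff.1 (Finset.mem_range.1 hl))]
    refine Finset.sum_congr rfl fun j _ => ?_
    rw [Nat.add_sub_cancel_left, add_comm l j]
  · intro k l
    simp only [Finset.mem_range, Finset.mem_Ico]
    omega

/-- The element `∑ xⁱ vᵢ`, `i < N`, with coefficients on the right. -/
noncomputable def rightSum (δ : SkewDerivation (σ : F →+* F)) (N : ℕ) (v : ℕ → F) :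
    OrePolynomial (σ : F →+* F) δ :=
  ∑ i ∈ Finset.range N, x ^ i * constHom _ _ (v i)

theorem rightSum_add (N : ℕ) (v w : ℕ → F) :
    rightSum δ N (fun i => v i + w i) = rightSum δ N v + rightSum δ N w := by
  simp only [rightSum, map_add, mul_add, Finset.sum_add_distrib]

theorem rightSum_sub (N : ℕ) (v w : ℕ → F) :
    rightSum δ N (fun i => v i - w i) = rightSum δ N v - rightSum δ N w := by
  simp only [rightSum, map_sub, mul_sub, Finset.sum_sub_distrib]

theorem rightSum_congr {N : ℕ} {v w : ℕ → F} (h : ∀ i < N, v i = w i) :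
    rightSum δ N v = rightSum δ N w :=
  Finset.sum_congr rfl fun i hi => by rw [h i (Finset.mem_range.1 hi)]

theorem degree_x_pow_mul_constHom (i : ℕ) (a : F) :
    (x ^ i * constHom (σ : F →+* F) δ a).toPoly.degree = i + (C a).degree := by
  rw [degree_mul, toPoly_x_pow, degree_X_pow, toPoly_constHom]

theorem degree_rightSum_lt (N : ℕ) (v : ℕ → F) : (rightSum δ N v).toPoly.degree < N := by
  rw [rightSum, toPoly_sum, ← mem_degreeLT]
  refine Submodule.sum_mem _ fun i hi => ?_
  rw [mem_degreeLT, degree_x_pow_mul_constHom]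
  calc (i : WithBot ℕ) + (C (v i)).degree ≤ i + 0 := add_le_add le_rfl degree_C_le
    _ < N := by rw [add_zero]; exact_mod_cast Finset.mem_range.1 hi

/-- A nonzero top coefficient would give a term of degree exactly N, which the lower terms cannot
cancel; so the coefficients vanish from the top down. -/
theorem eq_zero_of_rightSum_eq_zero {N : ℕ} {v : ℕ → F} (h : rightSum δ N v = 0) :
    ∀ i < N, v i = 0 := by
  induction N with
  | zero => simp
  | succ N ih =>
    have hN : v N = 0 := by
      by_contra hne
      rw [rightSum, Finset.sum_range_succ, ← rightSum] at h
      have h1 := degree_rightSum_lt (δ := δ) N v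
      rw [eq_neg_of_add_eq_zero_left h, toPoly_neg, degree_neg, degree_x_pow_mul_constHom,
        degree_C hne, add_zero] at h1
      exact lt_irrefl _ h1
    rw [rightSum, Finset.sum_range_succ, hN, map_zero, mul_zero, add_zero] at h
    intro i hi
    rcases Nat.lt_succ_iff_lt_or_eq.1 hi with hi | rfl
    exacts [ih h i hi, hN]

theorem rightSum_injOn {N : ℕ} {v w : ℕ → F} (h : rightSum δ N v = rightSum δ N w) :
    ∀ i < N, v i = w i := by
  rw [← sub_eq_zero, ← rightSum_sub] at h
  exact fun i hi => sub_eq_zero.1 (eq_zero_of_rightSum_eq_zero h i hi)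

theorem exists_eq_rightSum {N : ℕ} (hN : 0 < N) {f : OrePolynomial (σ : F →+* F) δ}
    (hf : f.toPoly.degree < N) : ∃ v, f = rightSum δ N v := by
  -- For `f = 0` the degree defaults to 0, and the bound comes from `hN`.
  have hlt : f.natDegree + 1 ≤ N := by
    by_cases h0 : f.toPoly = 0
    · simpa [natDegree, h0] using Nat.succ_le_of_lt hN
    · exact (natDegree_lt_iff_degree_lt h0).2 hf
  refine ⟨fun i => if i < f.natDegree + 1 then f.rightCoeff i else 0, ?_⟩
  rw [rightSum, ← Finset.sum_subset (Finset.range_subset_range.2 hlt)]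
  · conv_lhs => rw [f.eq_sum_rightCoeff]
    exact Finset.sum_congr rfl fun i hi => by rw [if_pos (Finset.mem_range.1 hi)]
  · intro i _ hi
    rw [if_neg fun h => hi (Finset.mem_range.2 h), map_zero, mul_zero]

end RightCoefficients

/-! ### The Sylvester matrix and Bézout identities -/

section Sylvester

variable {F : Type*} [DivisionRing F] {σ : F ≃+* F} {δ : SkewDerivation (σ : F →+* F)}

/-- The substitution is q = i + l; the guard `l ≤ q` excludes spurious values of truncated
subtraction. -/
theorem sum_range_shift {M : Type*} [AddCommMonoid M] (G : ℕ → ℕ → M) {m l N : ℕ}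
    (hN : m + l < N) :
    ∑ i ∈ Finset.range (m + 1), G (i + l) i =
      ∑ q ∈ Finset.range N, if l ≤ q ∧ q - l ≤ m then G q (q - l) else 0 := by
  rw [← Finset.sum_filter]
  refine Finset.sum_nbij' (fun i => i + l) (fun q => q - l) ?_ ?_ ?_ ?_ ?_ <;>
    simp only [Finset.mem_filter, Finset.mem_range]
  · omega
  · omega
  · omega
  · omega
  · intro i _
    rw [Nat.add_sub_cancel]

/-- Moving each right coefficient of `f` past xᵖ yields powers xˡ, and xⁱxˡ contributes to row q = i
+ l. The constant c stays rightmost. -/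
theorem mul_x_pow_mul_constHom (f : OrePolynomial (σ : F →+* F) δ) {p N : ℕ}
    (hN : f.natDegree + p < N) (c : F) :
    f * (x ^ p * constHom _ _ c) = rightSum δ N fun q => f.sylvesterEntry p q * c := by
  conv_lhs => rw [f.eq_sum_rightCoeff]
  rw [Finset.sum_mul]
  calc ∑ i ∈ Finset.range (f.natDegree + 1),
        x ^ i * constHom _ _ (f.rightCoeff i) * (x ^ p * constHom _ _ c)
      = ∑ i ∈ Finset.range (f.natDegree + 1), ∑ l ∈ Finset.range (p + 1),
        x ^ (i + l) * constHom _ _ ((-1) ^ (p - l) * opT δ (p - l) l (f.rightCoeff i) * c) := by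
        refine Finset.sum_congr rfl fun i _ => ?_
        rw [mul_assoc, ← mul_assoc (constHom _ _ _), constHom_mul_x_pow, Finset.sum_mul,
          Finset.mul_sum]
        refine Finset.sum_congr rfl fun l _ => ?_
        rw [pow_add, map_mul _ _ c]
        simp only [mul_assoc]
    _ = rightSum δ N fun q => f.sylvesterEntry p q * c := by
        rw [Finset.sum_comm, rightSum]
        simp only [sylvesterEntry, Finset.sum_mul, map_sum, Finset.mul_sum]
        rw [Finset.sum_comm (s := Finset.range N)]
        refine Finset.sum_congr rfl fun l hl => ?_
        rw [Finset.mem_range] at hl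
        rw [sum_range_shift (fun q i => x ^ q * constHom (σ : F →+* F) δ
          ((-1) ^ (p - l) * opT δ (p - l) l (f.rightCoeff i) * c)) (N := N) (by omega)]
        refine Finset.sum_congr rfl fun q _ => ?_
        split_ifs <;> simp

theorem mul_rightSum (f : OrePolynomial (σ : F →+* F) δ) {n N : ℕ}
    (hN : f.natDegree + n ≤ N) (u : ℕ → F) :
    f * rightSum δ n u =
      rightSum δ N fun q => ∑ p ∈ Finset.range n, f.sylvesterEntry p q * u p := by
  have h : ∀ p ∈ Finset.range n, f * (x ^ p * constHom _ _ (u p)) =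
      rightSum δ N fun q => f.sylvesterEntry p q * u p := fun p hp =>
    mul_x_pow_mul_constHom f (by rw [Finset.mem_range] at hp; omega) (u p)
  rw [rightSum, Finset.mul_sum, Finset.sum_congr rfl h]
  simp only [rightSum, map_sum, Finset.mul_sum]
  exact Finset.sum_comm

open Matrix in
theorem leftSylvester_mulVec (f g : OrePolynomial (σ : F →+* F) δ) (u : ℕ → F)
    (q : Fin (f.natDegree + g.natDegree)) :
    (leftSylvester f g *ᵥ fun i => u i) q =
      ∑ p ∈ Finset.range g.natDegree, f.sylvesterEntry p q * u p +
        ∑ p ∈ Finset.range f.natDegree, g.sylvesterEntry p q * u (g.natDegree + p) := by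
  have h : (leftSylvester f g *ᵥ fun i => u i) q =
      ∑ p ∈ Finset.range (f.natDegree + g.natDegree),
        (if p < g.natDegree then f.sylvesterEntry p q
          else g.sylvesterEntry (p - g.natDegree) q) * u p := by
    rw [Finset.sum_range]
    rfl
  -- The degrees are swapped because the block of unknowns of c comes first and has deg g columns.
  rw [h, congrArg Finset.range (add_comm f.natDegree g.natDegree), Finset.sum_range_add]
  congr 1
  · exact Finset.sum_congr rfl fun p hp => by rw [if_pos (Finset.mem_range.1 hp)]
  · exact Finset.sum_congr rfl fun p _ => by
      rw [if_neg (by omega), Nat.add_sub_cancel_left]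

open Matrix in
/-- The Sylvester matrix is the matrix of `(c, d) ↦ f c + g d` in terms of right coefficients. -/
theorem leftSylvester_mulVec_eq_iff (f g : OrePolynomial (σ : F →+* F) δ) (u w : ℕ → F) :
    (leftSylvester f g *ᵥ fun i => u i) = (fun i : Fin (f.natDegree + g.natDegree) => w i) ↔
      f * rightSum δ g.natDegree u + g * rightSum δ f.natDegree (fun p => u (g.natDegree + p)) =
        rightSum δ (f.natDegree + g.natDegree) w := by
  rw [mul_rightSum f (N := f.natDegree + g.natDegree) le_rfl,
    mul_rightSum g (N := f.natDegree + g.natDegree) (add_comm _ _).le, ← rightSum_add]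
  constructor
  · intro h
    refine rightSum_congr fun i hi => ?_
    have := congrFun h ⟨i, hi⟩
    rwa [leftSylvester_mulVec] at this
  · intro h
    ext i
    rw [leftSylvester_mulVec]
    exact rightSum_injOn h i i.2

/-- Vectors become restrictions of sequences, so that blocks of different lengths can be handled
without casts between `Fin` types. -/
theorem exists_nat_extension {α : Type*} [Nonempty α] {N : ℕ} (v : Fin N → α) :
    ∃ u : ℕ → α, v = fun i : Fin N => u i :=
  ⟨fun i => if h : i < N then v ⟨i, h⟩ else Classical.arbitrary α, by ext i; simp⟩

/-- If the left resultant does not vanish, then `1` is a combination of `f` and `g`. -/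
theorem exists_bezout_of_leftResultant_ne_zero (f g : OrePolynomial (σ : F →+* F) δ)
    (hf : 0 < f.natDegree) (h : leftResultant f g ≠ 0) :
    ∃ p q : OrePolynomial (σ : F →+* F) δ, f * p + g * q = 1 := by
  have hinj : Function.Injective (leftSylvester f g).mulVec := by
    intro v w hvw
    by_contra hne
    refine h ((dieudonneDet_eq_zero_iff _).2 ⟨v - w, sub_ne_zero.2 hne, ?_⟩)
    rw [Matrix.mulVec_sub, sub_eq_zero]
    exact hvw
  -- The target is the vector of right coefficients of 1.
  obtain ⟨v, hv⟩ := (mulVec_injective_iff_surjective _).1 hinj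
    fun i => (fun k : ℕ => if k = 0 then (1 : F) else 0) i
  obtain ⟨u, rfl⟩ := exists_nat_extension v
  refine ⟨_, _, ((leftSylvester_mulVec_eq_iff f g u fun k => if k = 0 then 1 else 0).1 hv).trans ?_⟩
  rw [rightSum, Finset.sum_eq_single 0]
  · simp
  · intro i _ hi
    simp [hi]
  · intro h0
    exact absurd (Finset.mem_range.2 (by omega)) h0

/-- If `1` is a combination of `f` and `g` and `f c + g d = 0` with `c ≠ 0` of degree less than
`deg g`, then every element of degree less than `deg f + deg g` is a combination of `f` and `g`
with coefficients of degree less than `deg g` and `deg f`. -/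
theorem exists_combination_of_bezout {f g : OrePolynomial (σ : F →+* F) δ}
    (hf : 0 < f.natDegree) (hg : 0 < g.natDegree)
    {p q : OrePolynomial (σ : F →+* F) δ} (hpq : f * p + g * q = 1)
    {c d : OrePolynomial (σ : F →+* F) δ} (hc : c ≠ 0) (hcdeg : c.toPoly.degree < g.natDegree)
    (hcd : f * c + g * d = 0) (y : OrePolynomial (σ : F →+* F) δ)
    (hy : y.toPoly.degree < (f.natDegree + g.natDegree : ℕ)) :
    ∃ r s : OrePolynomial (σ : F →+* F) δ, r.toPoly.degree < g.natDegree ∧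
      s.toPoly.degree < f.natDegree ∧ f * r + g * s = y := by
  -- The pair (py, qy) represents y, and so does (py - ck, qy - dk), since fc + gd = 0.
  obtain ⟨k, r, hk, hr⟩ := exists_eq_mul_add c hc (p * y)
  have hsum : f * r + g * (q * y - d * k) = y := by
    have h1 : r = p * y - c * k := by rw [hk, add_sub_cancel_left]
    calc f * r + g * (q * y - d * k)
        = (f * p + g * q) * y - (f * c + g * d) * k := by rw [h1]; noncomm_ring
      _ = y := by rw [hpq, hcd, one_mul, zero_mul, sub_zero]
  refine ⟨r, q * y - d * k, hr.trans hcdeg, ?_, hsum⟩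
  have hdeg : ∀ e : OrePolynomial (σ : F →+* F) δ, 0 < e.natDegree →
      e.toPoly.degree = e.natDegree := fun e he =>
    degree_eq_natDegree fun h0 => by simp [natDegree, h0] at he
  have hfr : (f * r).toPoly.degree < (f.natDegree + g.natDegree : ℕ) := by
    rw [degree_mul, hdeg f hf, Nat.cast_add]
    exact WithBot.add_lt_add_left WithBot.coe_ne_bot (hr.trans hcdeg)
  -- The division gives no control of the second factor; its degree is read off from g s = y - f r.
  have hgs : (g * (q * y - d * k)).toPoly.degree < (f.natDegree + g.natDegree : ℕ) := by
    rw [eq_sub_of_add_eq' hsum, toPoly_sub]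
    exact (degree_sub_le _ _).trans_lt (max_lt hy hfr)
  rw [degree_mul, hdeg g hg, add_comm f.natDegree, Nat.cast_add] at hgs
  exact lt_of_add_lt_add_left hgs

/-- If `1` is a combination of `f` and `g`, then the left resultant does not vanish. -/
theorem leftResultant_ne_zero_of_bezout {f g : OrePolynomial (σ : F →+* F) δ}
    (hf : 0 < f.natDegree) (hg : 0 < g.natDegree)
    {p q : OrePolynomial (σ : F →+* F) δ} (hpq : f * p + g * q = 1) :
    leftResultant f g ≠ 0 := by
  intro h
  obtain ⟨v, hv, hMv⟩ := (dieudonneDet_eq_zero_iff _).1 h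
  -- The kernel vector is turned against itself: it yields surjectivity, hence injectivity, hence
  -- its own vanishing.
  refine hv ((mulVec_injective_iff_surjective (leftSylvester f g)).2 ?_
    (hMv.trans (Matrix.mulVec_zero _).symm))
  obtain ⟨u, rfl⟩ := exists_nat_extension v
  have hcd := (leftSylvester_mulVec_eq_iff f g u fun _ => 0).1 hMv
  rw [show rightSum δ (f.natDegree + g.natDegree) (fun _ => 0) = 0 by simp [rightSum]] at hcd
  have hg0 : g ≠ 0 := by rintro rfl; simp [natDegree] at hg
  -- If c = 0 then gd = 0, so d = 0 and the kernel vector is zero.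
  have hc : rightSum δ g.natDegree u ≠ 0 := by
    intro hc
    rw [hc, mul_zero, zero_add] at hcd
    have hd := eq_zero_of_rightSum_eq_zero ((mul_eq_zero.1 hcd).resolve_left hg0)
    refine hv (funext fun i => ?_)
    by_cases hi : (i : ℕ) < g.natDegree
    · exact eq_zero_of_rightSum_eq_zero hc i hi
    · have := hd (i - g.natDegree) (by omega)
      rwa [Nat.add_sub_cancel' (not_lt.1 hi)] at this
  intro y
  obtain ⟨w, rfl⟩ := exists_nat_extension y
  obtain ⟨r, s, hr, hs, hrs⟩ := exists_combination_of_bezout hf hg hpq hc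
    (degree_rightSum_lt _ _) hcd _ (degree_rightSum_lt _ w)
  obtain ⟨a, rfl⟩ := exists_eq_rightSum hg hr
  obtain ⟨b, rfl⟩ := exists_eq_rightSum hf hs
  refine ⟨_, (leftSylvester_mulVec_eq_iff f g
    (fun k => if k < g.natDegree then a k else b (k - g.natDegree)) w).2 ?_⟩
  rw [← hrs]
  congr 2
  · exact rightSum_congr fun i hi => if_pos hi
  · exact rightSum_congr fun i _ => by
      rw [if_neg (by omega), Nat.add_sub_cancel_left]

end Sylvester

end OrePolynomial

theorem theorem3p26 {F : Type*} [DivisionRing F] (σ : F ≃+* F)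
    (δ : SkewDerivation (σ : F →+* F)) (f g : OrePolynomial (σ : F →+* F) δ)
    (hf : 0 < f.natDegree) (hg : 0 < g.natDegree) :
    ((∃! d : OrePolynomial (σ : F →+* F) δ, d.Monic ∧ OrePolynomial.IsGCLD f g d) ∧
      (OrePolynomial.gcld f g).Monic ∧ OrePolynomial.IsGCLD f g (OrePolynomial.gcld f g)) ∧
    List.TFAE [
      OrePolynomial.leftResultant f g = 0,
      ∃ h : OrePolynomial (σ : F →+* F) δ, ¬ IsUnit h ∧ h ∣ f ∧ h ∣ g,
      OrePolynomial.gcld f g ≠ 1,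
      ¬ ∃ p q : OrePolynomial (σ : F →+* F) δ, f * p + g * q = 1,
      Submodule.span (OrePolynomial (σ : F →+* F) δ)ᵐᵒᵖ {f} ⊔
        Submodule.span (OrePolynomial (σ : F →+* F) δ)ᵐᵒᵖ {g} < ⊤] := by
  have hf0 : f ≠ 0 := by
    rintro rfl
    simp [OrePolynomial.natDegree] at hf
  refine ⟨⟨OrePolynomial.existsUnique_monic_isGCLD f g hf0, OrePolynomial.gcld_spec f g hf0⟩, ?_⟩
  tfae_have 1 ↔ 4 := by
    constructor
    · rintro h ⟨p, q, hpq⟩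
      exact OrePolynomial.leftResultant_ne_zero_of_bezout hf hg hpq h
    · intro h
      by_contra h1
      exact h (OrePolynomial.exists_bezout_of_leftResultant_ne_zero f g hf h1)
  tfae_have 2 ↔ 3 := OrePolynomial.exists_common_left_factor_iff f g hf0
  tfae_have 3 ↔ 4 := not_congr (OrePolynomial.gcld_eq_one_iff f g hf0)
  tfae_have 5 ↔ 4 := OrePolynomial.span_sup_span_lt_top_iff f g
  tfae_finish
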